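/- Let $f(z)=\sum_{n=0}^\infty a_n z^n$ be a non-constant entire function. For $r\ge 0$ put $$\mu_f(r)=\max_{n\ge 0}|a_n|r^n,\qquad S_f(r)=\Big(\sum_{n=0}^\infty |a_n|^2r^{2n}\Big)^{1/2}.$$ Let $(X_n)_{n\ge 0}$ be an independent sequence of complex random variables on a probability space $(\Omega,\mathcal A,\mathbb P)$ that is centred, that is, $\mathbb E(X_n)=0$ for all $n$, and subgaussian, that is, there are constants $K,\tau>0$ such that $\mathbb P(|X_n|>t)\le K e^{-t^2/\tau^2}$ for all $n\ge 0$ and all $t\ge 0$. Then, almost surely, the power series $\sum_{n=0}^\infty a_nX_nz^n$ converges for every $z\in\mathbb C$ and defines an entire function. Moreover, there exist an open set $E\subset[0,\infty)$ of finite logarithmic measure, that is, with $\int_{E\cap[1,\infty)}\frac{dr}{r}<\infty$, and a constant $C>0$ such that, almost surely, there exists $r_0>0$ such that $$\max_{|z|=r}\Big|\sum_{n=0}^\infty a_nX_nz^n\Big|\le C\sqrt{\log\log\mu_f(r)}\;S_f(r)$$ for every $r\ge r_0$ with $r\notin E$. (The set $E$ and the constant $C$ do not depend on $\omega\in\Omega$;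 the number $r_0$ may.) -/

import Mathlib

open MeasureTheory ProbabilityTheory Filter

namespace RandomEntire

noncomputable section

/-- A sequence of complex random variables is subgaussian if all its members satisfy the tail bound
`P(|X n| > t) ≤ K exp(-t² / τ²)`, `t ≥ 0`, with the same constants `K, τ > 0`. -/
def IsSubgaussianSeq {Ω : Type*} [MeasurableSpace Ω] (P : Measure Ω) (X : ℕ → Ω → ℂ) : Prop :=
  ∃ K τ : ℝ, 0 < K ∧ 0 < τ ∧ ∀ n : ℕ, ∀ t : ℝ, 0 ≤ t →
    P {ω | t < ‖X n ω‖} ≤ ENNReal.ofReal (K * Real.exp (-(t ^ 2) / τ ^ 2))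

/-- Each member of the sequence has expectation zero. -/
def IsCentredSeq {Ω : Type*} [MeasurableSpace Ω] (P : Measure Ω) (X : ℕ → Ω → ℂ) : Prop :=
  ∀ n : ℕ, Integrable (X n) P ∧ ∫ ω, X n ω ∂P = 0

/-- The sum `∑ cₙ zⁿ` of a power series. -/
def powerSum (c : ℕ → ℂ) (z : ℂ) : ℂ := ∑' n : ℕ, c n * z ^ n

/-- The power series `∑ cₙ zⁿ` converges at every point of the plane, and its sum is entire. -/
def DefinesEntire (c : ℕ → ℂ) : Prop :=
  (∀ z : ℂ, Summable fun n : ℕ => c n * z ^ n) ∧ Differentiable ℂ (powerSum c)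

/-- The maximum modulus `max_{|z| = r} |F z|`; the supremum is attained when `F` is continuous
and `r ≥ 0`. -/
def maxModulus (F : ℂ → ℂ) (r : ℝ) : ℝ := sSup ((fun z : ℂ => ‖F z‖) '' Metric.sphere 0 r)

/-- The maximum term `μ_f(r) = max_n |aₙ| rⁿ` of `f = ∑ aₙ zⁿ`; the supremum is attained when `f`
is entire and `r ≥ 0`. -/
def maxTerm (a : ℕ → ℂ) (r : ℝ) : ℝ := ⨆ n : ℕ, ‖a n‖ * r ^ n

/-- `S_f(r) = (∑ |aₙ|² r²ⁿ)^(1/2)`; the series converges when `f = ∑ aₙ zⁿ` is entire. -/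
def quadMean (a : ℕ → ℂ) (r : ℝ) : ℝ := Real.sqrt (∑' n : ℕ, ‖a n‖ ^ 2 * r ^ (2 * n))

/-- `E` is measurable and `∫_{E ∩ [1,∞)} dr / r < ∞`. -/
def HasFiniteLogMeasure (E : Set ℝ) : Prop :=
  MeasurableSet E ∧ ∫⁻ r in E ∩ Set.Ici 1, ENNReal.ofReal (1 / r) < ⊤

end

end RandomEntire

/-! Put m = ⌊log μ_f(r)⌋ + 1. Outside a set E built from μ_f alone, μ_f(r(1 + 1/(2m²))) is still
below e^m, so the terms of f decay geometrically and those with n ≥ 8m⁸ are negligible, even when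
weighted by the almost surely linear growth of |X_n| (`exists_finiteLogMeasure_forall_lt`,
`linear_mul_term_le_of_geometric_decay`).

What remains is a random polynomial with N = 8m⁸ terms. In the coordinate w = log z one lattice of
mesh N⁻³ serves all radii belonging to the same m, and it has only O(m⁵⁰) points. At each point
Hoeffding's inequality (`measure_norm_sum_ge_le`) bounds the polynomial by a multiple of √(log m)
S_f, with exceptional probability O(m⁻⁵²). The union bound leaves O(m⁻²), and Borel–Cantelli
applies. Since log m is comparable to log log μ_f(r), this is the required rate.

The errors have size D(ω) S_f(r), with D(ω) the random growth constant. As √(log log μ_f) tends to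
infinity it absorbs D(ω) for r ≥ r₀(ω), so C stays deterministic. -/

namespace RandomEntire

/-! ### Subgaussian variables: from tails to moment generating functions. -/

/-- A Gaussian tail bound gives a uniform bound on a Gaussian exponential moment. -/
lemma exists_bound_integral_exp_sq_of_tail {Ω : Type*} [MeasurableSpace Ω] (P : Measure Ω)
    [IsProbabilityMeasure P] {K τ : ℝ} (hτ : 0 < τ) :
    ∃ M : ℝ, 0 ≤ M ∧ ∀ g : Ω → ℝ, Measurable g → (∀ ω, 0 ≤ g ω) →
      (∀ t : ℝ, 0 ≤ t → P {ω | t < g ω} ≤ ENNReal.ofReal (K * Real.exp (-(t ^ 2) / τ ^ 2))) →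
      Integrable (fun ω => Real.exp (1 / (2 * τ ^ 2) * g ω ^ 2)) P ∧
        ∫ ω, Real.exp (1 / (2 * τ ^ 2) * g ω ^ 2) ∂P ≤ M := by
  -- Half the rate of the tail: in the layer-cake formula the weight 2αt exp(αt²) meets the tail
  -- exp(-2αt²), leaving an integrable t exp(-αt²).
  set α : ℝ := 1 / (2 * τ ^ 2) with hα
  have hα0 : 0 < α := by positivity
  have hint : Integrable (fun t : ℝ => (2 * α * |K|) * (t * Real.exp (-α * t ^ 2))) :=
    (integrable_mul_exp_neg_mul_sq hα0).const_mul _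
  set J : ENNReal := ∫⁻ t in Set.Ioi (0 : ℝ),
    ENNReal.ofReal ((2 * α * |K|) * (t * Real.exp (-α * t ^ 2))) with hJ
  have hJtop : J ≠ ⊤ := by
    have h1 : J ≤ ∫⁻ t : ℝ, ‖(2 * α * |K|) * (t * Real.exp (-α * t ^ 2))‖ₑ := by
      refine (setLIntegral_le_lintegral _ _).trans (lintegral_mono fun t => ?_)
      exact Real.ofReal_le_enorm _
    exact (h1.trans_lt hint.2).ne
  refine ⟨1 + J.toReal, by positivity, fun g hg hg0 htail => ?_⟩
  have hprim : ∀ b : ℝ, ∫ t in (0 : ℝ)..b, 2 * α * t * Real.exp (α * t ^ 2)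
      = Real.exp (α * b ^ 2) - 1 := by
    intro b
    have hd : ∀ t ∈ Set.uIcc 0 b, HasDerivAt (fun t : ℝ => Real.exp (α * t ^ 2))
        (2 * α * t * Real.exp (α * t ^ 2)) t := by
      intro t _
      have h := ((hasDerivAt_pow 2 t).const_mul α).exp
      convert h using 1
      push_cast
      ring
    rw [intervalIntegral.integral_eq_sub_of_hasDerivAt hd]
    · simp
    · exact Continuous.intervalIntegrable (by fun_prop) _ _
  have hlayer := lintegral_comp_eq_lintegral_meas_lt_mul P (f := g)
    (g := fun t => 2 * α * t * Real.exp (α * t ^ 2)) (ae_of_all _ hg0) hg.aemeasurable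
    (fun t _ => Continuous.intervalIntegrable (by fun_prop) _ _)
    (by
      filter_upwards [ae_restrict_mem measurableSet_Ioi] with t ht
      have : 0 < t := ht
      positivity)
  simp_rw [hprim] at hlayer
  have hle : ∫⁻ ω, ENNReal.ofReal (Real.exp (α * g ω ^ 2) - 1) ∂P ≤ J := by
    rw [hlayer]
    refine setLIntegral_mono' measurableSet_Ioi fun t ht => ?_
    have ht0 : 0 < t := ht
    refine (mul_le_mul_left (htail t ht0.le) _).trans ?_
    have hK : K * Real.exp (-(t ^ 2) / τ ^ 2) ≤ |K| * Real.exp (-(t ^ 2) / τ ^ 2) := by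
      gcongr
      exact le_abs_self K
    refine (mul_le_mul_left (ENNReal.ofReal_le_ofReal hK) _).trans ?_
    rw [← ENNReal.ofReal_mul (by positivity)]
    refine ENNReal.ofReal_le_ofReal (le_of_eq ?_)
    have he : Real.exp (-α * t ^ 2) = Real.exp (-(t ^ 2) / τ ^ 2) * Real.exp (α * t ^ 2) := by
      rw [← Real.exp_add]
      congr 1
      rw [hα]
      field_simp
      ring
    rw [he]
    ring
  have hnn : 0 ≤ᵐ[P] fun ω => Real.exp (α * g ω ^ 2) - 1 := by
    refine ae_of_all _ fun ω => ?_
    have : 0 ≤ α * g ω ^ 2 := by positivity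
    simpa using Real.one_le_exp this
  have hmeas : AEStronglyMeasurable (fun ω => Real.exp (α * g ω ^ 2) - 1) P :=
    Measurable.aestronglyMeasurable (by fun_prop)
  have hi : Integrable (fun ω => Real.exp (α * g ω ^ 2) - 1) P :=
    (lintegral_ofReal_ne_top_iff_integrable hmeas hnn).1 (hle.trans_lt hJtop.lt_top).ne
  have hi2 : Integrable (fun ω => Real.exp (α * g ω ^ 2)) P :=
    (hi.add (integrable_const (1 : ℝ))).congr (ae_of_all _ fun ω => by simp)
  refine ⟨hi2, ?_⟩
  have h2 : ∫ ω, (Real.exp (α * g ω ^ 2) - 1) ∂P ≤ J.toReal := by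
    rw [integral_eq_lintegral_of_nonneg_ae hnn hmeas]
    exact ENNReal.toReal_mono hJtop hle
  rw [integral_sub hi2 (integrable_const _)] at h2
  simp at h2
  linarith

/-- Second-order Taylor remainder. The linear term is kept exact so that centring removes it after
integration. -/
lemma exp_le_one_add_add_sq_mul_exp_abs (y : ℝ) :
    Real.exp y ≤ 1 + y + y ^ 2 * Real.exp |y| := by
  have h := Complex.norm_exp_sub_sum_le_norm_mul_exp (y : ℂ) 2
  simp only [Finset.sum_range_succ, Finset.sum_range_zero] at h
  have h2 : ((Complex.exp y - (0 + (y : ℂ) ^ 0 / (Nat.factorial 0 : ℂ)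
      + (y : ℂ) ^ 1 / (Nat.factorial 1 : ℂ))) : ℂ) = ((Real.exp y - (1 + y) : ℝ) : ℂ) := by
    push_cast
    simp
  rw [h2, Complex.norm_real, Complex.norm_real, Real.norm_eq_abs, Real.norm_eq_abs, sq_abs] at h
  linarith [le_abs_self (Real.exp y - (1 + y))]

/-- A centred random variable with a Gaussian exponential moment is subgaussian. -/
lemma hasSubgaussianMGF_of_integral_exp_sq {Ω : Type*} [MeasurableSpace Ω] {P : Measure Ω}
    [IsProbabilityMeasure P] {α M : ℝ} (hα : 0 < α) (hM : 0 ≤ M) {Y : Ω → ℝ}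
    (hYi : Integrable Y P) (hY0 : ∫ ω, Y ω ∂P = 0)
    (hexp : Integrable (fun ω => Real.exp (α * Y ω ^ 2)) P)
    (hbound : ∫ ω, Real.exp (α * Y ω ^ 2) ∂P ≤ M) :
    HasSubgaussianMGF Y (Real.toNNReal (4 * M / α + 1 / α)) P := by
  -- The available exponent αy² is split in two: one half dominates the factor y², the other
  -- dominates exp |sy| by the arithmetic-geometric inequality.
  have hpt : ∀ s y : ℝ, Real.exp (s * y)
      ≤ 1 + s * y + s ^ 2 * (2 / α) * Real.exp (s ^ 2 / (2 * α)) * Real.exp (α * y ^ 2) := by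
    intro s y
    refine (exp_le_one_add_add_sq_mul_exp_abs (s * y)).trans ?_
    have h1 : |s * y| ≤ s ^ 2 / (2 * α) + α / 2 * y ^ 2 := by
      rw [abs_mul]
      have h := two_mul_le_add_sq |s| (α * |y|)
      have h' : |s| * |y| = (2 * |s| * (α * |y|)) / (2 * α) := by field_simp
      have h'' : s ^ 2 / (2 * α) + α / 2 * y ^ 2 = (|s| ^ 2 + (α * |y|) ^ 2) / (2 * α) := by
        rw [mul_pow, sq_abs, sq_abs]
        field_simp
      rw [h', h'']
      gcongr
    have h2 : y ^ 2 ≤ 2 / α * Real.exp (α / 2 * y ^ 2) := by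
      have h := Real.add_one_le_exp (α / 2 * y ^ 2)
      have h' : y ^ 2 = 2 / α * (α / 2 * y ^ 2) := by field_simp
      calc y ^ 2 = 2 / α * (α / 2 * y ^ 2) := h'
        _ ≤ 2 / α * Real.exp (α / 2 * y ^ 2) := by gcongr; linarith
    have h3 : (s * y) ^ 2 * Real.exp |s * y|
        ≤ s ^ 2 * (2 / α * Real.exp (α / 2 * y ^ 2))
          * Real.exp (s ^ 2 / (2 * α) + α / 2 * y ^ 2) := by
      rw [mul_pow]
      gcongr
    have h4 : s ^ 2 * (2 / α * Real.exp (α / 2 * y ^ 2))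
          * Real.exp (s ^ 2 / (2 * α) + α / 2 * y ^ 2)
        = s ^ 2 * (2 / α) * Real.exp (s ^ 2 / (2 * α)) * Real.exp (α * y ^ 2) := by
      have : Real.exp (α * y ^ 2) = Real.exp (α / 2 * y ^ 2) * Real.exp (α / 2 * y ^ 2) := by
        rw [← Real.exp_add]; congr 1; ring
      rw [Real.exp_add, this]
      ring
    linarith
  have hdom : ∀ s : ℝ, Integrable (fun ω => 1 + s * Y ω
      + s ^ 2 * (2 / α) * Real.exp (s ^ 2 / (2 * α)) * Real.exp (α * Y ω ^ 2)) P := fun s =>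
    ((integrable_const (1 : ℝ)).add (hYi.const_mul s)).add (hexp.const_mul _)
  have hint : ∀ s : ℝ, Integrable (fun ω => Real.exp (s * Y ω)) P := by
    intro s
    refine (hdom s).mono' ?_ (ae_of_all _ fun ω => ?_)
    · exact Real.continuous_exp.comp_aestronglyMeasurable (hYi.1.const_mul s)
    · rw [Real.norm_eq_abs, Real.abs_exp]
      exact hpt s (Y ω)
  refine ⟨hint, fun s => ?_⟩
  have h1 : mgf Y P s ≤ ∫ ω, (1 + s * Y ω
      + s ^ 2 * (2 / α) * Real.exp (s ^ 2 / (2 * α)) * Real.exp (α * Y ω ^ 2)) ∂P :=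
    integral_mono (hint s) (hdom s) fun ω => hpt s (Y ω)
  have hlin : Integrable (fun ω => 1 + s * Y ω) P :=
    (integrable_const (1 : ℝ)).add (hYi.const_mul s)
  rw [integral_add hlin (hexp.const_mul _),
    integral_add (integrable_const (1 : ℝ)) (hYi.const_mul s), integral_const_mul,
    integral_const_mul, hY0] at h1
  simp only [integral_const, probReal_univ, smul_eq_mul, mul_one, mul_zero, add_zero] at h1
  rw [Real.coe_toNNReal _ (by positivity)]
  set v : ℝ := s ^ 2 / (2 * α)
  have hv : 0 ≤ v := by positivity
  set u : ℝ := s ^ 2 * (2 / α) * M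
  have hu : 0 ≤ u := by positivity
  have h2 : s ^ 2 * (2 / α) * Real.exp v * ∫ ω, Real.exp (α * Y ω ^ 2) ∂P ≤ u * Real.exp v := by
    calc _ ≤ s ^ 2 * (2 / α) * Real.exp v * M := by gcongr
      _ = u * Real.exp v := by ring
  calc mgf Y P s ≤ 1 + u * Real.exp v := by linarith
    _ ≤ Real.exp v + u * Real.exp v := by gcongr; exact Real.one_le_exp hv
    _ = (u + 1) * Real.exp v := by ring
    _ ≤ Real.exp u * Real.exp v := by gcongr; exact Real.add_one_le_exp u
    _ = Real.exp ((4 * M / α + 1 / α) * s ^ 2 / 2) := by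
      rw [← Real.exp_add]
      congr 1
      simp only [u, v]
      field_simp
      ring

/-- The real parts of unimodular multiples of the members of a centred subgaussian sequence have
subgaussian moment generating functions, with a common parameter. -/
lemma IsSubgaussianSeq.exists_hasSubgaussianMGF {Ω : Type*} [MeasurableSpace Ω] {P : Measure Ω}
    [IsProbabilityMeasure P] {X : ℕ → Ω → ℂ} (hX_meas : ∀ n, Measurable (X n))
    (hX_centred : IsCentredSeq P X) (hX : IsSubgaussianSeq P X) :
    ∃ v : NNReal, 0 < v ∧ ∀ n (u : ℂ), ‖u‖ ≤ 1 →
      HasSubgaussianMGF (fun ω => (u * X n ω).re) v P := by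
  obtain ⟨K, τ, -, hτ, htail⟩ := hX
  obtain ⟨M, hM, hbound⟩ := exists_bound_integral_exp_sq_of_tail P (K := K) hτ
  have hα : 0 < 1 / (2 * τ ^ 2) := by positivity
  refine ⟨Real.toNNReal (4 * M / (1 / (2 * τ ^ 2)) + 1 / (1 / (2 * τ ^ 2))),
    Real.toNNReal_pos.2 (by positivity), fun n u hu => ?_⟩
  obtain ⟨hXi, hX0⟩ := hX_centred n
  have hiX : Integrable (fun ω => u * X n ω) P := hXi.const_mul u
  obtain ⟨h1, h2⟩ := hbound (fun ω => ‖X n ω‖) (hX_meas n).norm (fun _ => norm_nonneg _) (htail n)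
  have hle : ∀ ω, Real.exp (1 / (2 * τ ^ 2) * (u * X n ω).re ^ 2)
      ≤ Real.exp (1 / (2 * τ ^ 2) * ‖X n ω‖ ^ 2) := by
    intro ω
    have h : |(u * X n ω).re| ≤ ‖X n ω‖ := by
      refine (Complex.abs_re_le_norm _).trans ?_
      rw [norm_mul]
      exact mul_le_of_le_one_left (norm_nonneg _) hu
    have h' : (u * X n ω).re ^ 2 ≤ ‖X n ω‖ ^ 2 := by
      rw [← sq_abs]
      gcongr
    gcongr
  have hi : Integrable (fun ω => Real.exp (1 / (2 * τ ^ 2) * (u * X n ω).re ^ 2)) P := by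
    refine h1.mono' ?_ (ae_of_all _ fun ω => ?_)
    · have := hX_meas n
      exact Measurable.aestronglyMeasurable (by fun_prop)
    · rw [Real.norm_eq_abs, Real.abs_exp]
      exact hle ω
  refine hasSubgaussianMGF_of_integral_exp_sq hα hM hiX.re ?_ hi
    ((integral_mono hi h1 hle).trans h2)
  have h := integral_re hiX
  rw [integral_const_mul, hX0] at h
  simpa using h

/-! ### Hoeffding's inequality and almost sure growth. -/

lemma _root_.Complex.exists_unit_re_ge (z : ℂ) :
    ∃ u ∈ ({1, -1, -Complex.I, Complex.I} : Finset ℂ), ‖z‖ / 2 ≤ (u * z).re := by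
  have h := Complex.norm_le_abs_re_add_abs_im z
  rcases le_total |z.im| |z.re| with h1 | h1
  · rcases abs_cases z.re with ⟨h2, -⟩ | ⟨h2, -⟩
    · exact ⟨1, by simp, by simp; linarith⟩
    · exact ⟨-1, by simp, by simp; linarith⟩
  · rcases abs_cases z.im with ⟨h2, -⟩ | ⟨h2, -⟩
    · exact ⟨-Complex.I, by simp, by simp; linarith⟩
    · exact ⟨Complex.I, by simp, by simp; linarith⟩

/-- Hoeffding's inequality for complex linear combinations of independent random variables whose
real parts, after rotation, are subgaussian. -/
lemma measure_norm_sum_ge_le {Ω : Type*} [MeasurableSpace Ω] {P : Measure Ω}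
    [IsProbabilityMeasure P] {X : ℕ → Ω → ℂ} (hX_indep : iIndepFun X P) {v : NNReal} (hv : 0 < v)
    (hsub : ∀ n (u : ℂ), ‖u‖ ≤ 1 → HasSubgaussianMGF (fun ω => (u * X n ω).re) v P)
    (c : ℕ → ℂ) (s : Finset ℕ) {B t : ℝ} (hB : 0 < B) (ht : 0 ≤ t)
    (hcB : ∑ n ∈ s, ‖c n‖ ^ 2 ≤ B ^ 2) :
    P {ω | t * B ≤ ‖∑ n ∈ s, c n * X n ω‖}
      ≤ ENNReal.ofReal (4 * Real.exp (-(t ^ 2) / (8 * v))) := by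
  have hone : ∀ u : ℂ, ‖u‖ = 1 →
      P.real {ω | t * B / 2 ≤ (u * ∑ n ∈ s, c n * X n ω).re}
        ≤ Real.exp (-(t ^ 2) / (8 * v)) := by
    intro u hu
    have hg : ∀ n, HasSubgaussianMGF (fun ω => (u * (c n * X n ω)).re)
        (Real.toNNReal (‖c n‖ ^ 2) * v) P := by
      intro n
      by_cases hc : c n = 0
      · simp [hc]
      -- The phase of `c n` joins the rotation `u`, so only the real factor `‖c n‖` scales the
      -- variance proxy.
      have hw : ‖u * (c n / ‖c n‖)‖ ≤ 1 := by simp [hu, hc]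
      have h := (hsub n _ hw).const_mul ‖c n‖
      have hc' : (‖c n‖ : ℂ) ≠ 0 := by simpa using hc
      convert h using 1
      · ext ω
        rw [← Complex.re_ofReal_mul]
        congr 1
        field_simp
      · congr 1
        exact Real.toNNReal_of_nonneg (by positivity)
    have hindep : iIndepFun (fun n ω => (u * (c n * X n ω)).re) P :=
      hX_indep.comp (fun n z => (u * (c n * z)).re) fun n => by fun_prop
    have hsum := HasSubgaussianMGF.sum_of_iIndepFun hindep (s := s) fun n _ => hg n
    have hsum' : HasSubgaussianMGF (fun ω => (u * ∑ n ∈ s, c n * X n ω).re)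
        (Real.toNNReal (B ^ 2) * v) P := by
      have heq : (fun ω => (u * ∑ n ∈ s, c n * X n ω).re)
          = fun ω => ∑ n ∈ s, (u * (c n * X n ω)).re := by
        ext ω
        rw [Finset.mul_sum, Complex.re_sum]
      rw [heq]
      refine ⟨hsum.integrable_exp_mul, fun r => (hsum.mgf_le r).trans ?_⟩
      rw [← Finset.sum_mul]
      push_cast
      have : ∑ n ∈ s, ((Real.toNNReal (‖c n‖ ^ 2) : NNReal) : ℝ)
          ≤ ((Real.toNNReal (B ^ 2) : NNReal) : ℝ) := by
        rw [Real.coe_toNNReal _ (by positivity)]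
        refine le_trans (le_of_eq ?_) hcB
        exact Finset.sum_congr rfl fun n _ => Real.coe_toNNReal _ (by positivity)
      gcongr
    refine (hsum'.measure_ge_le (by positivity)).trans (le_of_eq ?_)
    congr 1
    push_cast
    rw [Real.coe_toNNReal _ (by positivity)]
    have hv' : (v : ℝ) ≠ 0 := by exact_mod_cast hv.ne'
    field_simp
    ring
  set U : Finset ℂ := {1, -1, -Complex.I, Complex.I}
  have hU : ∀ u ∈ U, ‖u‖ = 1 := by
    intro u hu
    simp only [U, Finset.mem_insert, Finset.mem_singleton] at hu
    rcases hu with rfl | rfl | rfl | rfl <;> simp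
  have hsubset : {ω | t * B ≤ ‖∑ n ∈ s, c n * X n ω‖}
      ⊆ ⋃ u ∈ U, {ω | t * B / 2 ≤ (u * ∑ n ∈ s, c n * X n ω).re} := by
    intro ω hω
    obtain ⟨u, hu, hu2⟩ := Complex.exists_unit_re_ge (∑ n ∈ s, c n * X n ω)
    simp only [Set.mem_iUnion]
    refine ⟨u, hu, ?_⟩
    have : t * B ≤ ‖∑ n ∈ s, c n * X n ω‖ := hω
    change t * B / 2 ≤ _
    linarith
  refine (measure_mono hsubset).trans ((measure_biUnion_finset_le _ _).trans ?_)
  have hcard : (U.card : ℝ) ≤ 4 := by exact_mod_cast Finset.card_le_four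
  calc ∑ u ∈ U, P {ω | t * B / 2 ≤ (u * ∑ n ∈ s, c n * X n ω).re}
      ≤ ∑ u ∈ U, ENNReal.ofReal (Real.exp (-(t ^ 2) / (8 * v))) := by
        refine Finset.sum_le_sum fun u hu => ?_
        rw [← ofReal_measureReal]
        exact ENNReal.ofReal_le_ofReal (hone u (hU u hu))
    _ = ENNReal.ofReal (U.card * Real.exp (-(t ^ 2) / (8 * v))) := by
        rw [Finset.sum_const, nsmul_eq_mul, ENNReal.ofReal_mul (by positivity),
          ENNReal.ofReal_natCast]
    _ ≤ _ := by
        apply ENNReal.ofReal_le_ofReal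
        gcongr

/-- Almost surely, a sequence with uniform Gaussian tails grows at most linearly. -/
lemma IsSubgaussianSeq.ae_exists_linear_bound {Ω : Type*} [MeasurableSpace Ω] {P : Measure Ω}
    {X : ℕ → Ω → ℂ} (hX : IsSubgaussianSeq P X) :
    ∀ᵐ ω ∂P, ∃ D : ℝ, 0 < D ∧ ∀ n : ℕ, ‖X n ω‖ ≤ D * (n + 1) := by
  obtain ⟨K, τ, hK, hτ, htail⟩ := hX
  have hsummable : Summable fun n : ℕ => K * Real.exp (-((n : ℝ) ^ 2) / τ ^ 2) := by
    refine Summable.mul_left K ?_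
    have hs : Summable fun n : ℕ => Real.exp ((n : ℝ) * (-(1 / τ ^ 2))) :=
      Real.summable_exp_nat_mul_iff.2 (by simp; positivity)
    refine hs.of_nonneg_of_le (fun _ => (Real.exp_pos _).le) fun n => ?_
    apply Real.exp_le_exp.2
    have h : (n : ℝ) ≤ (n : ℝ) ^ 2 := by exact_mod_cast Nat.le_self_pow two_ne_zero n
    have : (n : ℝ) * (-(1 / τ ^ 2)) = -(n : ℝ) / τ ^ 2 := by ring
    rw [this]
    gcongr
  have hne : ∑' n : ℕ, P {ω | (n : ℝ) < ‖X n ω‖} ≠ ⊤ :=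
    ne_top_of_le_ne_top hsummable.tsum_ofReal_ne_top
      (ENNReal.tsum_le_tsum fun n => htail n n (Nat.cast_nonneg n))
  filter_upwards [ae_eventually_notMem hne] with ω hω
  obtain ⟨N, hN⟩ := eventually_atTop.1 hω
  refine ⟨1 + ∑ i ∈ Finset.range N, ‖X i ω‖,
    by positivity, fun n => ?_⟩
  have hsum : 0 ≤ ∑ i ∈ Finset.range N, ‖X i ω‖ := by positivity
  have hn : (0 : ℝ) ≤ n := Nat.cast_nonneg n
  rcases lt_or_ge n N with h | h
  · have h1 := Finset.single_le_sum (f := fun i => ‖X i ω‖) (fun i _ => norm_nonneg _)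
      (Finset.mem_range.2 h)
    nlinarith
  · have h1 : ‖X n ω‖ ≤ n := not_lt.1 (hN n h)
    nlinarith

/-! ### Entire power series, maximum term and quadratic mean. -/

lemma summable_norm_mul_pow {f : ℂ → ℂ} {a : ℕ → ℂ}
    (hf : ∀ z : ℂ, HasSum (fun n : ℕ => a n * z ^ n) (f z)) {r : ℝ} (hr : 0 ≤ r) :
    Summable fun n : ℕ => ‖a n‖ * r ^ n := by
  have h := (hf r).summable.norm
  simpa [abs_of_nonneg hr] using h

section EntireCoefficients

variable {a : ℕ → ℂ} (ha : ∀ r : ℝ, 0 ≤ r → Summable fun n : ℕ => ‖a n‖ * r ^ n)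

include ha

lemma summable_linear_mul_norm_mul_pow {r : ℝ} (hr : 0 ≤ r) :
    Summable fun n : ℕ => ‖a n‖ * (n + 1) * r ^ n := by
  refine (ha (2 * r) (by positivity)).of_nonneg_of_le (fun n => by positivity) fun n => ?_
  have h : (n : ℝ) + 1 ≤ 2 ^ n := by exact_mod_cast Nat.lt_two_pow_self
  calc ‖a n‖ * (n + 1) * r ^ n ≤ ‖a n‖ * 2 ^ n * r ^ n := by gcongr
    _ = ‖a n‖ * (2 * r) ^ n := by rw [mul_pow]; ring

lemma summable_norm_mul_pow_of_linear_bound {x : ℕ → ℂ} {D : ℝ}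
    (hx : ∀ n : ℕ, ‖x n‖ ≤ D * (n + 1)) {r : ℝ} (hr : 0 ≤ r) :
    Summable fun n : ℕ => ‖a n * x n‖ * r ^ n := by
  refine ((summable_linear_mul_norm_mul_pow ha hr).mul_left D).of_nonneg_of_le
    (fun n => by positivity) fun n => ?_
  rw [norm_mul]
  calc ‖a n‖ * ‖x n‖ * r ^ n ≤ ‖a n‖ * (D * (n + 1)) * r ^ n := by gcongr; exact hx n
    _ = D * (‖a n‖ * (n + 1) * r ^ n) := by ring

omit ha in
lemma definesEntire_of_summable {c : ℕ → ℂ}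
    (hc : ∀ r : ℝ, 0 ≤ r → Summable fun n : ℕ => ‖c n‖ * r ^ n) : DefinesEntire c := by
  refine ⟨fun z => Summable.of_norm (by simpa using hc ‖z‖ (norm_nonneg z)), fun z => ?_⟩
  have h : DifferentiableOn ℂ (fun w : ℂ => ∑' n : ℕ, c n * w ^ n)
      (Metric.ball 0 (‖z‖ + 1)) := by
    refine Complex.differentiableOn_tsum_of_summable_norm (hc (‖z‖ + 1) (by positivity))
      (fun n => by fun_prop) Metric.isOpen_ball fun n w hw => ?_
    rw [norm_mul, norm_pow]
    have : ‖w‖ ≤ ‖z‖ + 1 := by simpa using (mem_ball_zero_iff.1 hw).le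
    gcongr
  exact h.differentiableAt (Metric.isOpen_ball.mem_nhds (by simp))

lemma norm_mul_pow_le_maxTerm {r : ℝ} (hr : 0 ≤ r) (n : ℕ) : ‖a n‖ * r ^ n ≤ maxTerm a r := by
  refine le_ciSup (f := fun n : ℕ => ‖a n‖ * r ^ n) ⟨∑' n : ℕ, ‖a n‖ * r ^ n, ?_⟩ n
  rintro _ ⟨k, rfl⟩
  exact (ha r hr).le_tsum k fun j _ => by positivity

lemma maxTerm_mono {r s : ℝ} (hr : 0 ≤ r) (hrs : r ≤ s) : maxTerm a r ≤ maxTerm a s := by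
  refine ciSup_le fun n => le_trans ?_ (norm_mul_pow_le_maxTerm ha (hr.trans hrs) n)
  gcongr

lemma summable_sq_norm_mul_pow {r : ℝ} (hr : 0 ≤ r) :
    Summable fun n : ℕ => ‖a n‖ ^ 2 * r ^ (2 * n) := by
  refine ((ha r hr).mul_left (maxTerm a r)).of_nonneg_of_le (fun n => by positivity) fun n => ?_
  calc ‖a n‖ ^ 2 * r ^ (2 * n) = (‖a n‖ * r ^ n) * (‖a n‖ * r ^ n) := by ring
    _ ≤ maxTerm a r * (‖a n‖ * r ^ n) := by
      gcongr
      exact norm_mul_pow_le_maxTerm ha hr n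

omit ha in
lemma quadMean_sq {r : ℝ} (hr : 0 ≤ r) :
    quadMean a r ^ 2 = ∑' n : ℕ, ‖a n‖ ^ 2 * r ^ (2 * n) :=
  Real.sq_sqrt (tsum_nonneg fun n => by positivity)

lemma sum_sq_le_quadMean_sq {r : ℝ} (hr : 0 ≤ r) (s : Finset ℕ) :
    ∑ n ∈ s, ‖a n‖ ^ 2 * r ^ (2 * n) ≤ quadMean a r ^ 2 := by
  rw [quadMean_sq hr]
  exact (summable_sq_norm_mul_pow ha hr).sum_le_tsum s fun n _ => by positivity

lemma maxTerm_le_quadMean {r : ℝ} (hr : 0 ≤ r) : maxTerm a r ≤ quadMean a r := by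
  refine ciSup_le fun n => abs_le_of_sq_le_sq' ?_ (Real.sqrt_nonneg _) |>.2
  have h := sum_sq_le_quadMean_sq ha hr {n}
  rw [Finset.sum_singleton] at h
  calc (‖a n‖ * r ^ n) ^ 2 = ‖a n‖ ^ 2 * r ^ (2 * n) := by ring
    _ ≤ _ := h

lemma quadMean_mono {r s : ℝ} (hr : 0 ≤ r) (hrs : r ≤ s) : quadMean a r ≤ quadMean a s := by
  refine Real.sqrt_le_sqrt ((summable_sq_norm_mul_pow ha hr).tsum_le_tsum (fun n => ?_)
    (summable_sq_norm_mul_pow ha (hr.trans hrs)))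
  gcongr

end EntireCoefficients

/-! ### The exceptional set and the tail of the series. -/

/-- For a monotone unbounded function `μ`, outside an open set of finite logarithmic measure,
increasing `r` slightly does not make `μ r` cross the next of a given sequence of levels. -/
lemma exists_finiteLogMeasure_forall_lt {μ : ℝ → ℝ} (hμ : MonotoneOn μ (Set.Ici 0))
    {L ε : ℕ → ℝ} (hL : ∀ k, ∃ r, 0 ≤ r ∧ L k ≤ μ r) (hε : ∀ k, 0 < ε k) (hε2 : ∀ k, ε k ≤ 1 / 2)
    (hεs : Summable ε) :
    ∃ E : Set ℝ, IsOpen E ∧ E ⊆ Set.Ici 0 ∧ HasFiniteLogMeasure E ∧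
      ∀ r, 0 < r → r ∉ E → ∀ k, μ r < L k → μ (r * (1 + ε k)) < L k := by
  -- The radius where level `L k` is crossed. A point below it and outside `I k` is at most ρ(1 -
  -- ε), and (1 - ε)(1 + ε) < 1.
  set ρ : ℕ → ℝ := fun k => sInf {r | 0 ≤ r ∧ L k ≤ μ r} with hρ
  have hbdd : ∀ k, BddBelow {r | 0 ≤ r ∧ L k ≤ μ r} := fun k => ⟨0, fun r hr => hr.1⟩
  have hρ0 : ∀ k, 0 ≤ ρ k := fun k => Real.sInf_nonneg fun r hr => hr.1
  set I : ℕ → Set ℝ := fun k => Set.Ioo (ρ k * (1 - ε k)) (ρ k * (1 + ε k)) with hI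
  have hopen : IsOpen (⋃ k, I k) := isOpen_iUnion fun k => isOpen_Ioo
  refine ⟨⋃ k, I k, hopen, ?_, ⟨hopen.measurableSet, ?_⟩, ?_⟩
  · refine Set.iUnion_subset fun k r hr => ?_
    have h1 : 0 ≤ ρ k * (1 - ε k) := mul_nonneg (hρ0 k) (by linarith [hε2 k])
    exact h1.trans hr.1.le
  · have hone : ∀ k, ∫⁻ r in I k, ENNReal.ofReal (1 / r) ≤ ENNReal.ofReal (4 * ε k) := by
      intro k
      rcases (hρ0 k).eq_or_lt with h0 | h0
      · simp [hI, ← h0]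
      have hle : ∀ r ∈ I k, ENNReal.ofReal (1 / r) ≤ ENNReal.ofReal (2 / ρ k) := by
        intro r hr
        apply ENNReal.ofReal_le_ofReal
        have h1 : ρ k / 2 ≤ r := by nlinarith [hr.1, hε2 k]
        calc 1 / r ≤ 1 / (ρ k / 2) := by gcongr
          _ = 2 / ρ k := by field_simp
      calc ∫⁻ r in I k, ENNReal.ofReal (1 / r)
          ≤ ∫⁻ r in I k, ENNReal.ofReal (2 / ρ k) := setLIntegral_mono' measurableSet_Ioo hle
        _ = ENNReal.ofReal (4 * ε k) := by
          rw [setLIntegral_const, Real.volume_Ioo, ← ENNReal.ofReal_mul (by positivity)]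
          congr 1
          field_simp
          ring
    calc ∫⁻ r in (⋃ k, I k) ∩ Set.Ici 1, ENNReal.ofReal (1 / r)
        ≤ ∫⁻ r in ⋃ k, I k, ENNReal.ofReal (1 / r) := lintegral_mono_set Set.inter_subset_left
      _ ≤ ∑' k, ∫⁻ r in I k, ENNReal.ofReal (1 / r) := lintegral_iUnion_le _ _
      _ ≤ ∑' k, ENNReal.ofReal (4 * ε k) := ENNReal.tsum_le_tsum hone
      _ < ⊤ := (hεs.mul_left 4).tsum_ofReal_lt_top
  · intro r hr hrE k hk
    have hrρ : r ≤ ρ k := by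
      obtain ⟨s, hs⟩ := hL k
      refine le_csInf ⟨s, hs⟩ fun s hs => ?_
      by_contra! h
      exact absurd (hμ hs.1 hr.le h.le) (by linarith [hs.2])
    have hρpos : 0 < ρ k := hr.trans_le hrρ
    have h1 : r ≤ ρ k * (1 - ε k) := by
      by_contra! h
      exact hrE (Set.mem_iUnion.2 ⟨k, h, by nlinarith [hε k]⟩)
    have h2 : r * (1 + ε k) < ρ k := by
      have := hε k
      calc r * (1 + ε k) ≤ ρ k * (1 - ε k) * (1 + ε k) := by gcongr
        _ = ρ k - ρ k * ε k ^ 2 := by ring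
        _ < ρ k := by
          have : 0 < ρ k * ε k ^ 2 := by positivity
          linarith
    by_contra! h
    have hnn : 0 ≤ r * (1 + ε k) := mul_nonneg hr.le (by linarith [hε k])
    exact absurd (csInf_le (hbdd k) ⟨hnn, h⟩) (not_le.2 h2)

/-- Terms of high index are negligible when the maximum term grows little near the radius `r`. -/
lemma linear_mul_term_le_of_geometric_decay {m n : ℕ} (hm : 1 ≤ m) (hn : 8 * m ^ 8 ≤ n) {y : ℝ}
    (hy : y * (1 + 1 / (2 * (m : ℝ) ^ 2)) ^ n ≤ Real.exp m) (hy0 : 0 ≤ y) :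
    y * (n + 1) ≤ 24576 / (n : ℝ) ^ 2 := by
  have hm' : (1 : ℝ) ≤ m := by exact_mod_cast hm
  have hn' : 8 * (m : ℝ) ^ 8 ≤ n := by exact_mod_cast hn
  have hn1 : (1 : ℝ) ≤ n := by nlinarith [one_le_pow₀ hm' (n := 8)]
  set ε : ℝ := 1 / (2 * (m : ℝ) ^ 2) with hε
  have hε0 : 0 < ε := by positivity
  have hε1 : ε ≤ 1 / 2 := by
    rw [hε]
    gcongr
    nlinarith
  have hbase : Real.exp (ε / 2) ≤ 1 + ε := by
    refine (Real.exp_bound_div_one_sub_of_interval (by positivity) (by linarith)).trans ?_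
    rw [div_le_iff₀ (by linarith)]
    nlinarith
  have hpow : Real.exp (n / (4 * (m : ℝ) ^ 2)) ≤ (1 + ε) ^ n := by
    calc Real.exp (n / (4 * (m : ℝ) ^ 2)) = Real.exp (ε / 2) ^ n := by
          rw [← Real.exp_nat_mul]
          congr 1
          rw [hε]
          field_simp
          ring
      _ ≤ _ := by gcongr
  have hmn : (m : ℝ) ≤ n / (8 * (m : ℝ) ^ 2) := by
    rw [le_div_iff₀ (by positivity)]
    have : (m : ℝ) ^ 3 ≤ (m : ℝ) ^ 8 := pow_le_pow_right₀ hm' (by norm_num)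
    nlinarith
  set u : ℝ := n / (8 * (m : ℝ) ^ 2) with hu
  have hu0 : 0 < u := by positivity
  have h1 : y * Real.exp u ≤ 1 := by
    have h2 : y * Real.exp (2 * u) ≤ Real.exp u := by
      have : (n : ℝ) / (4 * (m : ℝ) ^ 2) = 2 * u := by rw [hu]; field_simp; ring
      rw [this] at hpow
      calc y * Real.exp (2 * u) ≤ y * (1 + ε) ^ n := by gcongr
        _ ≤ Real.exp m := hy
        _ ≤ Real.exp u := Real.exp_le_exp.2 hmn
    rw [two_mul, Real.exp_add, ← mul_assoc] at h2
    exact le_of_mul_le_mul_right (by linarith) (Real.exp_pos u)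
  have h3 : u ^ 4 / 24 ≤ Real.exp u := by
    simpa [Nat.factorial] using Real.pow_div_factorial_le_exp u hu0.le 4
  have h4 : y * u ^ 4 ≤ 24 := by nlinarith
  -- This fixes the cutoff 8m⁸: the fourth power of u = n/(8m²) produces m⁸, which is at most n/8
  -- and so costs a single power of n.
  have h5 : y * (n : ℝ) ^ 4 ≤ 24 * 8 ^ 4 * (m : ℝ) ^ 8 := by
    have : u ^ 4 = (n : ℝ) ^ 4 / (8 ^ 4 * (m : ℝ) ^ 8) := by rw [hu]; field_simp
    rw [this, ← mul_div_assoc, div_le_iff₀ (by positivity)] at h4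
    linarith
  have h6 : y * (n : ℝ) ^ 4 ≤ 12288 * n := by linarith
  rw [le_div_iff₀ (by positivity)]
  have h7 : y * (n : ℝ) ^ 3 ≤ 12288 :=
    le_of_mul_le_mul_right (by linarith) (lt_of_lt_of_le one_pos hn1)
  calc y * (n + 1) * (n : ℝ) ^ 2 ≤ y * (2 * n) * (n : ℝ) ^ 2 := by gcongr; linarith
    _ = 2 * (y * (n : ℝ) ^ 3) := by ring
    _ ≤ 24576 := by linarith

/-! ### Discretisation in logarithmic coordinates. -/

/-- A power series is bounded by a partial sum and a bound for the remaining terms. -/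
lemma norm_powerSum_le {c : ℕ → ℂ} {z : ℂ} (N : ℕ) {b : ℕ → ℝ} (hb : Summable b)
    (hb0 : ∀ n, 0 ≤ b n) (hcs : Summable fun n => c n * z ^ n)
    (hcb : ∀ n, N ≤ n → ‖c n * z ^ n‖ ≤ b n) :
    ‖powerSum c z‖ ≤ ‖∑ n ∈ Finset.range N, c n * z ^ n‖ + ∑' n, b n := by
  rw [powerSum, ← hcs.sum_add_tsum_nat_add N]
  refine (norm_add_le _ _).trans ?_
  gcongr
  have hbs : Summable fun n => b (n + N) := (summable_nat_add_iff N).2 hb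
  refine (tsum_of_norm_bounded hbs.hasSum fun n => hcb _ (Nat.le_add_left N n)).trans ?_
  rw [← hb.sum_add_tsum_nat_add N]
  have := Finset.sum_nonneg fun n (_ : n ∈ Finset.range N) => hb0 n
  linarith

/-- In logarithmic coordinates, a polynomial changes little under a small perturbation. -/
lemma norm_sum_exp_le_of_near {c : ℕ → ℂ} {N : ℕ} (hN : 2 ≤ N) {w w' : ℂ} {D μ : ℝ} (hD : 0 ≤ D)
    (hc : ∀ n, ‖c n‖ * Real.exp w.re ^ n ≤ D * (n + 1) * μ) (hμ : 0 ≤ μ)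
    (hw : ‖w' - w‖ ≤ 2 / (N : ℝ) ^ 3) :
    ‖∑ n ∈ Finset.range N, c n * Complex.exp w ^ n‖
      ≤ ‖∑ n ∈ Finset.range N, c n * Complex.exp w' ^ n‖ + 4 * D * μ := by
  have hN0 : (2 : ℝ) ≤ N := by exact_mod_cast hN
  have hterm : ∀ n ∈ Finset.range N,
      ‖c n * Complex.exp w ^ n - c n * Complex.exp w' ^ n‖ ≤ 4 * D * μ / N := by
    intro n hn
    have hnN : (n : ℝ) + 1 ≤ N := by exact_mod_cast Finset.mem_range.1 hn
    -- Of the three powers of N in the mesh, one pays for the exponent n, one for the weight n + 1,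
    -- one for the number of terms.
    have hnw : ‖(n : ℂ) * (w' - w)‖ ≤ 2 / (N : ℝ) ^ 2 := by
      rw [norm_mul, Complex.norm_natCast]
      calc (n : ℝ) * ‖w' - w‖ ≤ N * (2 / (N : ℝ) ^ 3) := by
              gcongr
              exact (Finset.mem_range.1 hn).le
        _ = 2 / (N : ℝ) ^ 2 := by field_simp
    have hle1 : 2 / (N : ℝ) ^ 2 ≤ 1 := by
      rw [div_le_one (by positivity)]
      nlinarith
    have h1 := Complex.norm_exp_sub_one_le (hnw.trans hle1)
    have h2 : c n * Complex.exp w ^ n - c n * Complex.exp w' ^ n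
        = -(c n * Complex.exp w ^ n * (Complex.exp (n * (w' - w)) - 1)) := by
      have : Complex.exp w' ^ n = Complex.exp w ^ n * Complex.exp (n * (w' - w)) := by
        rw [← Complex.exp_nat_mul, ← Complex.exp_nat_mul, ← Complex.exp_add]
        congr 1
        ring
      rw [this]
      ring
    rw [h2, norm_neg, norm_mul, norm_mul, norm_pow, Complex.norm_exp]
    calc ‖c n‖ * Real.exp w.re ^ n * ‖Complex.exp (n * (w' - w)) - 1‖
        ≤ (D * (n + 1) * μ) * (2 * (2 / (N : ℝ) ^ 2)) := by
          exact mul_le_mul (hc n) (h1.trans (by gcongr)) (norm_nonneg _) (by positivity)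
      _ ≤ (D * N * μ) * (2 * (2 / (N : ℝ) ^ 2)) := by gcongr
      _ = 4 * D * μ / N := by field_simp; ring
  have hsum : ‖∑ n ∈ Finset.range N, c n * Complex.exp w ^ n
      - ∑ n ∈ Finset.range N, c n * Complex.exp w' ^ n‖ ≤ 4 * D * μ := by
    rw [← Finset.sum_sub_distrib]
    refine (norm_sum_le_of_le _ hterm).trans (le_of_eq ?_)
    rw [Finset.sum_const, Finset.card_range, nsmul_eq_mul]
    field_simp
  have := norm_sub_norm_le (∑ n ∈ Finset.range N, c n * Complex.exp w ^ n)
    (∑ n ∈ Finset.range N, c n * Complex.exp w' ^ n)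
  linarith

/-- The points of a square lattice of mesh `1 / N ^ 3` in the first quadrant. -/
noncomputable def latticePoint (N i j : ℕ) : ℂ :=
  ⟨(i : ℝ) / (N : ℝ) ^ 3, (j : ℝ) / (N : ℝ) ^ 3⟩

/-- Coordinates are rounded down: the lattice radius does not exceed that of `w`, so monotonicity of
`quadMean` applies. -/
lemma exists_latticePoint_near {N R₁ R₂ : ℕ} (hN : 1 ≤ N) {w : ℂ} (hx : 0 ≤ w.re)
    (hx' : w.re ≤ R₁) (hy : 0 ≤ w.im) (hy' : w.im ≤ R₂) :
    ∃ i < R₁ * N ^ 3 + 1, ∃ j < R₂ * N ^ 3 + 1, (latticePoint N i j).re ≤ w.re ∧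
      ‖latticePoint N i j - w‖ ≤ 2 / (N : ℝ) ^ 3 := by
  have hN0 : (0 : ℝ) < (N : ℝ) ^ 3 := by positivity
  have key : ∀ (x : ℝ) (R : ℕ), 0 ≤ x → x ≤ R → ∃ i < R * N ^ 3 + 1,
      (i : ℝ) / (N : ℝ) ^ 3 ≤ x ∧ |(i : ℝ) / (N : ℝ) ^ 3 - x| ≤ 1 / (N : ℝ) ^ 3 := by
    intro x R h0 hR
    have h1 : (⌊x * (N : ℝ) ^ 3⌋₊ : ℝ) / (N : ℝ) ^ 3 ≤ x := by
      rw [div_le_iff₀ hN0]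
      exact Nat.floor_le (by positivity)
    refine ⟨⌊x * (N : ℝ) ^ 3⌋₊, ?_, h1, ?_⟩
    · refine Nat.lt_succ_of_le (Nat.floor_le_of_le ?_)
      push_cast
      gcongr
    · rw [abs_sub_comm, abs_of_nonneg (by linarith), sub_le_iff_le_add, ← add_div,
        le_div_iff₀ hN0]
      linarith [Nat.lt_floor_add_one (x * (N : ℝ) ^ 3)]
  obtain ⟨i, hi, hi1, hi2⟩ := key w.re R₁ hx hx'
  obtain ⟨j, hj, -, hj2⟩ := key w.im R₂ hy hy'
  refine ⟨i, hi, j, hj, hi1, (Complex.norm_le_abs_re_add_abs_im _).trans ?_⟩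
  calc _ ≤ 1 / (N : ℝ) ^ 3 + 1 / (N : ℝ) ^ 3 := add_le_add hi2 hj2
    _ = 2 / (N : ℝ) ^ 3 := by ring

/-- A logarithm with argument in [0, 2π); 7 is an integer above 2π. -/
lemma exists_exp_eq_of_ne_zero {z : ℂ} (hz : z ≠ 0) :
    ∃ w : ℂ, Complex.exp w = z ∧ w.re = Real.log ‖z‖ ∧ 0 ≤ w.im ∧ w.im ≤ (7 : ℕ) := by
  have hpi := Real.pi_lt_d2
  rcases le_or_gt 0 z.arg with h | h
  · refine ⟨Complex.log z, Complex.exp_log hz, Complex.log_re z, by rwa [Complex.log_im], ?_⟩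
    rw [Complex.log_im]
    push_cast
    linarith [Complex.arg_le_pi z]
  · refine ⟨Complex.log z + 2 * Real.pi * Complex.I, ?_, ?_, ?_, ?_⟩
    · rw [Complex.exp_periodic, Complex.exp_log hz]
    · simp [Complex.log_re]
    · simp [Complex.log_im]
      linarith [Complex.neg_pi_lt_arg z]
    · simp [Complex.log_im]
      linarith

/-- Almost surely, for all large `m`, the random polynomials of degree less than `8 m ^ 8` are of
the expected size at all points of a fine lattice. -/
lemma ae_eventually_norm_sum_lattice_le {Ω : Type*} [MeasurableSpace Ω] {P : Measure Ω}
    [IsProbabilityMeasure P] {X : ℕ → Ω → ℂ} (hX_indep : iIndepFun X P) {v : NNReal} (hv : 0 < v)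
    (hsub : ∀ n (u : ℂ), ‖u‖ ≤ 1 → HasSubgaussianMGF (fun ω => (u * X n ω).re) v P)
    {a : ℕ → ℂ} (ha : ∀ r : ℝ, 0 ≤ r → Summable fun n : ℕ => ‖a n‖ * r ^ n)
    (hpos : ∀ r : ℝ, 0 < r → 0 < quadMean a r) :
    ∀ᵐ ω ∂P, ∀ᶠ m : ℕ in atTop, ∀ i < m ^ 2 * (8 * m ^ 8) ^ 3 + 1,
      ∀ j < 7 * (8 * m ^ 8) ^ 3 + 1,
      ‖∑ n ∈ Finset.range (8 * m ^ 8),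
          a n * X n ω * Complex.exp (latticePoint (8 * m ^ 8) i j) ^ n‖
        ≤ Real.sqrt (8 * v * 52) * Real.sqrt (Real.log m)
          * quadMean a (Real.exp (latticePoint (8 * m ^ 8) i j).re) := by
  set W : ℕ → ℕ → ℕ → ℂ := fun m i j => latticePoint (8 * m ^ 8) i j
  -- Chosen so that exp(-t²/(8v)) = m⁻⁵² for m ≥ 1, where 52 = 50 + 2: m⁵⁰ for the lattice points
  -- (m² · m²⁴ · m²⁴) and m² for summability.
  set t : ℕ → ℝ := fun m => Real.sqrt (8 * v * 52) * Real.sqrt (Real.log m)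
  set B : ℕ → ℕ → ℕ → Set Ω := fun m i j => {ω | t m * quadMean a (Real.exp (W m i j).re)
    ≤ ‖∑ n ∈ Finset.range (8 * m ^ 8), (a n * Complex.exp (W m i j) ^ n) * X n ω‖}
  set G : ℕ → Finset (ℕ × ℕ) := fun m =>
    Finset.range (m ^ 2 * (8 * m ^ 8) ^ 3 + 1) ×ˢ Finset.range (7 * (8 * m ^ 8) ^ 3 + 1)
  have hB : ∀ m i j, P (B m i j) ≤ ENNReal.ofReal (4 * Real.exp (-52 * Real.log m)) := by
    intro m i j
    refine (measure_norm_sum_ge_le hX_indep hv hsub _ _ (hpos _ (Real.exp_pos _))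
      (by positivity) ?_).trans (le_of_eq ?_)
    · refine le_trans (le_of_eq ?_) (sum_sq_le_quadMean_sq ha (Real.exp_pos (W m i j).re).le
        (Finset.range (8 * m ^ 8)))
      refine Finset.sum_congr rfl fun n _ => ?_
      rw [norm_mul, norm_pow, Complex.norm_exp]
      ring
    · congr 3
      have hlog : 0 ≤ Real.log m := Real.log_natCast_nonneg m
      have hv' : (v : ℝ) ≠ 0 := by exact_mod_cast hv.ne'
      simp only [t]
      rw [mul_pow, Real.sq_sqrt (by positivity), Real.sq_sqrt hlog]
      field_simp
  set b : ℕ → ℝ := fun m => (G m).card * (4 * Real.exp (-52 * Real.log m))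
  have hU : ∀ m, P (⋃ p ∈ G m, B m p.1 p.2) ≤ ENNReal.ofReal (b m) := by
    intro m
    refine (measure_biUnion_finset_le _ _).trans ((Finset.sum_le_sum fun p _ => hB m p.1 p.2).trans
      (le_of_eq ?_))
    rw [Finset.sum_const, nsmul_eq_mul, ← ENNReal.ofReal_natCast,
      ← ENNReal.ofReal_mul (by positivity)]
  have hbs : Summable b := by
    have hs : Summable fun m : ℕ => (16 * 8 ^ 6 * 4 : ℝ) * (1 / (m : ℝ) ^ 2) :=
      (Real.summable_one_div_nat_pow.2 one_lt_two).mul_left _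
    refine Summable.of_norm_bounded_eventually_nat hs ?_
    filter_upwards [eventually_ge_atTop 1] with m hm
    have hm' : (1 : ℝ) ≤ m := by exact_mod_cast hm
    have hm0 : (0 : ℝ) < m := by linarith
    rw [Real.norm_of_nonneg (by positivity)]
    have hexp : Real.exp (-52 * Real.log m) = 1 / (m : ℝ) ^ 52 := by
      have h52 : -52 * Real.log m = -((52 : ℕ) * Real.log m) := by push_cast; ring
      rw [h52, Real.exp_neg, Real.exp_nat_mul, Real.exp_log hm0, one_div]
    have hcard : ((G m).card : ℝ) ≤ 16 * 8 ^ 6 * (m : ℝ) ^ 50 := by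
      simp only [G, Finset.card_product, Finset.card_range]
      push_cast
      have h1 : (1 : ℝ) ≤ (8 * (m : ℝ) ^ 8) ^ 3 :=
        one_le_pow₀ (by linarith [one_le_pow₀ hm' (n := 8)])
      have h2 : (1 : ℝ) ≤ (m : ℝ) ^ 2 * (8 * (m : ℝ) ^ 8) ^ 3 :=
        one_le_mul_of_one_le_of_one_le (one_le_pow₀ hm') h1
      calc ((m : ℝ) ^ 2 * (8 * (m : ℝ) ^ 8) ^ 3 + 1) * (7 * (8 * (m : ℝ) ^ 8) ^ 3 + 1)
          ≤ (2 * ((m : ℝ) ^ 2 * (8 * (m : ℝ) ^ 8) ^ 3)) * (8 * (8 * (m : ℝ) ^ 8) ^ 3) := by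
            gcongr <;> linarith
        _ = 16 * 8 ^ 6 * (m : ℝ) ^ 50 := by ring
    simp only [b]
    rw [hexp]
    calc ((G m).card : ℝ) * (4 * (1 / (m : ℝ) ^ 52))
        ≤ 16 * 8 ^ 6 * (m : ℝ) ^ 50 * (4 * (1 / (m : ℝ) ^ 52)) := by gcongr
      _ = 16 * 8 ^ 6 * 4 * (1 / (m : ℝ) ^ 2) := by field_simp
  have hne : ∑' m, P (⋃ p ∈ G m, B m p.1 p.2) ≠ ⊤ :=
    ne_top_of_le_ne_top hbs.tsum_ofReal_ne_top (ENNReal.tsum_le_tsum hU)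
  filter_upwards [ae_eventually_notMem hne] with ω hω
  filter_upwards [hω] with m hm i hi j hj
  have hmem : (i, j) ∈ G m := Finset.mem_product.2 ⟨Finset.mem_range.2 hi, Finset.mem_range.2 hj⟩
  have h : ω ∉ B m i j := fun h => hm (Set.mem_iUnion₂.2 ⟨(i, j), hmem, h⟩)
  have h' : ‖∑ n ∈ Finset.range (8 * m ^ 8), (a n * Complex.exp (W m i j) ^ n) * X n ω‖
      ≤ t m * quadMean a (Real.exp (W m i j).re) := le_of_not_ge h
  refine le_trans (le_of_eq ?_) h'
  congr 1
  exact Finset.sum_congr rfl fun n _ => by ring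

/-- From lattice points to a whole circle: the bound for the sum of a power series with
coefficients `a n * x n`. -/
lemma norm_powerSum_le_of_lattice {a : ℕ → ℂ}
    (ha : ∀ r : ℝ, 0 ≤ r → Summable fun n : ℕ => ‖a n‖ * r ^ n)
    {x : ℕ → ℂ} {D : ℝ} (hD : 0 ≤ D) (hx : ∀ n : ℕ, ‖x n‖ ≤ D * (n + 1)) {m : ℕ} (hm : 1 ≤ m)
    {Λ : ℝ} (hΛ : 0 ≤ Λ)
    (hlat : ∀ i < m ^ 2 * (8 * m ^ 8) ^ 3 + 1, ∀ j < 7 * (8 * m ^ 8) ^ 3 + 1,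
      ‖∑ n ∈ Finset.range (8 * m ^ 8),
          a n * x n * Complex.exp (latticePoint (8 * m ^ 8) i j) ^ n‖
        ≤ Λ * quadMean a (Real.exp (latticePoint (8 * m ^ 8) i j).re))
    {z : ℂ} (hz : 1 ≤ ‖z‖) (hzm : Real.log ‖z‖ ≤ (m : ℝ) ^ 2)
    (hdecay : ∀ n, ‖a n‖ * ‖z‖ ^ n * (1 + 1 / (2 * (m : ℝ) ^ 2)) ^ n ≤ Real.exp m) :
    ‖powerSum (fun n => a n * x n) z‖ ≤ Λ * quadMean a ‖z‖ + 4 * D * maxTerm a ‖z‖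
      + D * ∑' n : ℕ, 24576 / (n : ℝ) ^ 2 := by
  have hz0 : z ≠ 0 := norm_pos_iff.1 (by linarith)
  have hs : Summable fun n : ℕ => (24576 : ℝ) / (n : ℝ) ^ 2 := by
    simpa [div_eq_mul_inv] using
      (Real.summable_one_div_nat_pow.2 one_lt_two).mul_left (24576 : ℝ)
  have hsum : Summable fun n => a n * x n * z ^ n :=
    (definesEntire_of_summable fun r hr => summable_norm_mul_pow_of_linear_bound ha hx hr).1 z
  have h1 := norm_powerSum_le (8 * m ^ 8) (hs.mul_left D) (fun n => by positivity) hsum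
    fun n hn => by
      have h := linear_mul_term_le_of_geometric_decay hm hn (hdecay n) (by positivity)
      rw [norm_mul, norm_mul, norm_pow]
      calc ‖a n‖ * ‖x n‖ * ‖z‖ ^ n ≤ ‖a n‖ * (D * (n + 1)) * ‖z‖ ^ n := by gcongr; exact hx n
        _ = D * (‖a n‖ * ‖z‖ ^ n * (n + 1)) := by ring
        _ ≤ _ := by gcongr
  rw [tsum_mul_left] at h1
  obtain ⟨w, hw, hwre, hwim, hwim'⟩ := exists_exp_eq_of_ne_zero hz0
  have hN : 8 ≤ 8 * m ^ 8 := Nat.le_mul_of_pos_right _ (by positivity)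
  obtain ⟨i, hi, j, hj, hre, hnear⟩ := exists_latticePoint_near (N := 8 * m ^ 8) (R₁ := m ^ 2)
    (R₂ := 7) (by omega) (w := w) (by rw [hwre]; exact Real.log_nonneg hz)
    (by rw [hwre]; exact_mod_cast hzm) hwim hwim'
  have hexp : Real.exp w.re = ‖z‖ := by rw [hwre, Real.exp_log (by linarith)]
  have hmax : 0 ≤ maxTerm a ‖z‖ :=
    le_trans (by positivity) (norm_mul_pow_le_maxTerm ha (norm_nonneg z) 0)
  have h2 := norm_sum_exp_le_of_near (c := fun n => a n * x n) (N := 8 * m ^ 8) (by omega) hD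
    (μ := maxTerm a ‖z‖) (w := w) (fun n => by
      rw [hexp, norm_mul]
      calc ‖a n‖ * ‖x n‖ * ‖z‖ ^ n ≤ ‖a n‖ * (D * (n + 1)) * ‖z‖ ^ n := by gcongr; exact hx n
        _ = D * (n + 1) * (‖a n‖ * ‖z‖ ^ n) := by ring
        _ ≤ _ := by
          gcongr
          exact norm_mul_pow_le_maxTerm ha (norm_nonneg z) n) hmax hnear
  rw [hw] at h2
  have h3 : quadMean a (Real.exp (latticePoint (8 * m ^ 8) i j).re) ≤ quadMean a ‖z‖ := by
    refine quadMean_mono ha (Real.exp_pos _).le ?_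
    rw [← hexp]
    gcongr
  have h4 := (hlat i hi j hj).trans (mul_le_mul_of_nonneg_left h3 hΛ)
  linarith

/-! ### Growth of the maximum term, and the theorem. -/

lemma exists_coeff_ne_zero {f : ℂ → ℂ} {a : ℕ → ℂ}
    (hf : ∀ z : ℂ, HasSum (fun n : ℕ => a n * z ^ n) (f z))
    (hf_nonconst : ¬ ∃ c : ℂ, ∀ z : ℂ, f z = c) : ∃ p, 1 ≤ p ∧ a p ≠ 0 := by
  by_contra! h
  refine hf_nonconst ⟨a 0, fun z => (hf z).unique ?_⟩
  have h0 := hasSum_single (f := fun n : ℕ => a n * z ^ n) 0 fun n hn => by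
    rw [h n (Nat.one_le_iff_ne_zero.2 hn), zero_mul]
  simpa using h0

lemma norm_coeff_mul_le_maxTerm {a : ℕ → ℂ}
    (ha : ∀ r : ℝ, 0 ≤ r → Summable fun n : ℕ => ‖a n‖ * r ^ n) {p : ℕ} (hp : 1 ≤ p) {r : ℝ}
    (hr : 1 ≤ r) : ‖a p‖ * r ≤ maxTerm a r := by
  refine le_trans ?_ (norm_mul_pow_le_maxTerm ha (by linarith) p)
  gcongr
  exact le_self_pow₀ hr (by omega)

lemma tendsto_maxTerm_atTop {a : ℕ → ℂ}
    (ha : ∀ r : ℝ, 0 ≤ r → Summable fun n : ℕ => ‖a n‖ * r ^ n) {p : ℕ} (hp : 1 ≤ p)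
    (hap : a p ≠ 0) : Tendsto (maxTerm a) atTop atTop := by
  refine tendsto_atTop_mono' _ ?_ (tendsto_id.const_mul_atTop (norm_pos_iff.2 hap))
  filter_upwards [eventually_ge_atTop 1] with r hr
  exact norm_coeff_mul_le_maxTerm ha hp hr

/-- For y ≥ 2 one has ⌊y⌋ + 1 ≤ y², so the logarithm at most doubles. -/
lemma sqrt_log_floor_add_one_le {y : ℝ} (hy : 2 ≤ y) :
    Real.sqrt (Real.log ((⌊y⌋₊ + 1 : ℕ) : ℝ)) ≤ 2 * Real.sqrt (Real.log y) := by
  have h1 : ((⌊y⌋₊ + 1 : ℕ) : ℝ) ≤ y ^ 2 := by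
    push_cast
    nlinarith [Nat.floor_le (show 0 ≤ y by linarith)]
  have h2 : Real.log ((⌊y⌋₊ + 1 : ℕ) : ℝ) ≤ 2 ^ 2 * Real.log y := by
    refine (Real.log_le_log (by positivity) h1).trans ?_
    rw [Real.log_pow]
    push_cast
    nlinarith [Real.log_nonneg (show 1 ≤ y by linarith)]
  refine (Real.sqrt_le_sqrt h2).trans (le_of_eq ?_)
  rw [Real.sqrt_mul (by norm_num), Real.sqrt_sq (by norm_num)]

end RandomEntire

open RandomEntire

theorem theorem3p5
    {Ω : Type*} [MeasurableSpace Ω] (P : Measure Ω) [IsProbabilityMeasure P]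
    (f : ℂ → ℂ) (a : ℕ → ℂ)
    (hf : ∀ z : ℂ, HasSum (fun n : ℕ => a n * z ^ n) (f z))
    (hf_nonconst : ¬ ∃ c : ℂ, ∀ z : ℂ, f z = c)
    (X : ℕ → Ω → ℂ)
    (hX_meas : ∀ n : ℕ, Measurable (X n))
    (hX_indep : iIndepFun X P)
    (hX_centred : RandomEntire.IsCentredSeq P X)
    (hX_subgaussian : RandomEntire.IsSubgaussianSeq P X) :
    (∀ᵐ ω ∂P, RandomEntire.DefinesEntire fun n => a n * X n ω) ∧
    ∃ E : Set ℝ, IsOpen E ∧ E ⊆ Set.Ici 0 ∧ RandomEntire.HasFiniteLogMeasure E ∧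
      ∃ C : ℝ, 0 < C ∧
        ∀ᵐ ω ∂P, ∃ r₀ : ℝ, 0 < r₀ ∧ ∀ r : ℝ, r₀ ≤ r → r ∉ E →
          RandomEntire.maxModulus (RandomEntire.powerSum fun n => a n * X n ω) r
            ≤ C * Real.sqrt (Real.log (Real.log (RandomEntire.maxTerm a r)))
                * RandomEntire.quadMean a r := by
  have ha : ∀ r : ℝ, 0 ≤ r → Summable fun n : ℕ => ‖a n‖ * r ^ n :=
    fun r hr => summable_norm_mul_pow hf hr
  have hlin := hX_subgaussian.ae_exists_linear_bound
  refine ⟨?_, ?_⟩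
  · filter_upwards [hlin] with ω ⟨D, _, hx⟩
    exact definesEntire_of_summable fun r hr => summable_norm_mul_pow_of_linear_bound ha hx hr
  obtain ⟨p, hp, hap⟩ := exists_coeff_ne_zero hf hf_nonconst
  have htend := tendsto_maxTerm_atTop ha hp hap
  have hpos : ∀ r : ℝ, 0 < r → 0 < quadMean a r := fun r hr => by
    have h1 : 0 < ‖a p‖ * r ^ p := mul_pos (norm_pos_iff.2 hap) (by positivity)
    exact h1.trans_le ((norm_mul_pow_le_maxTerm ha hr.le p).trans (maxTerm_le_quadMean ha hr.le))
  obtain ⟨E, hEo, hE0, hEm, hE⟩ := exists_finiteLogMeasure_forall_lt (μ := maxTerm a)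
    (fun r hr s _ hrs => maxTerm_mono ha hr hrs)
    (L := fun k => Real.exp ((k + 1 : ℕ) : ℝ))
    (ε := fun k => 1 / (2 * ((k + 1 : ℕ) : ℝ) ^ 2))
    (fun k => by
      obtain ⟨r, hr, hr'⟩ := ((eventually_ge_atTop (0 : ℝ)).and
        (htend.eventually_ge_atTop (Real.exp ((k + 1 : ℕ) : ℝ)))).exists
      exact ⟨r, hr, hr'⟩)
    (fun k => by positivity)
    (fun k => by
      have : (1 : ℝ) ≤ ((k + 1 : ℕ) : ℝ) := by exact_mod_cast Nat.le_add_left 1 k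
      gcongr
      nlinarith)
    (by
      have h := ((summable_nat_add_iff 1).2 (Real.summable_one_div_nat_pow.2 one_lt_two)).mul_left
        (1 / 2 : ℝ)
      refine h.congr fun k => ?_
      field_simp)
  obtain ⟨v, hv, hsub⟩ := hX_subgaussian.exists_hasSubgaussianMGF hX_meas hX_centred
  set A : ℝ := Real.sqrt (8 * v * 52) with hA
  have hA0 : 0 ≤ A := Real.sqrt_nonneg _
  refine ⟨E, hEo, hE0, hEm, 2 * A + 1, by positivity, ?_⟩
  filter_upwards [hlin, ae_eventually_norm_sum_lattice_le hX_indep hv hsub ha hpos]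
    with ω ⟨D, hD, hx⟩ hlat
  set T : ℝ := ∑' n : ℕ, 24576 / (n : ℝ) ^ 2
  have hT : 0 ≤ T := tsum_nonneg fun n => by positivity
  have hlogtend : Tendsto (fun r => Real.log (maxTerm a r)) atTop atTop :=
    Real.tendsto_log_atTop.comp htend
  have hsqrttend : Tendsto (fun r => Real.sqrt (Real.log (Real.log (maxTerm a r)))) atTop atTop :=
    Real.tendsto_sqrt_atTop.comp (Real.tendsto_log_atTop.comp hlogtend)
  have hfloor : Tendsto (fun r => ⌊Real.log (maxTerm a r)⌋₊ + 1) atTop atTop :=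
    (tendsto_add_atTop_nat 1).comp (tendsto_nat_floor_atTop.comp hlogtend)
  -- The second condition absorbs the random `D`; the third gives log μ ≥ 2 and keeps log r within
  -- the lattice range m².
  obtain ⟨r₁, hr₁⟩ := eventually_atTop.1 ((hfloor.eventually hlat).and
    ((hsqrttend.eventually_ge_atTop (D * (4 + T))).and
      (hlogtend.eventually_ge_atTop (2 + |Real.log ‖a p‖|))))
  refine ⟨max r₁ 1, by positivity, fun r hr hrE => ?_⟩
  obtain ⟨h1, h2, h3⟩ := hr₁ r ((le_max_left _ _).trans hr)
  have hr1 : 1 ≤ r := (le_max_right _ _).trans hr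
  have hr0 : 0 < r := by linarith
  set ℓ : ℝ := Real.log (maxTerm a r) with hℓ
  have hℓ2 : 2 ≤ ℓ := by linarith [abs_nonneg (Real.log ‖a p‖)]
  set m : ℕ := ⌊ℓ⌋₊ + 1 with hm
  have hm1 : 1 ≤ m := Nat.le_add_left 1 _
  have hℓm : ℓ < m := by
    rw [hm]
    push_cast
    exact Nat.lt_floor_add_one ℓ
  have hμ : ‖a p‖ * r ≤ maxTerm a r := norm_coeff_mul_le_maxTerm ha hp hr1
  have hap' : 0 < ‖a p‖ := norm_pos_iff.2 hap
  have hμ0 : 0 < maxTerm a r := (mul_pos hap' hr0).trans_le hμ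
  have hμ1 : 1 ≤ maxTerm a r := by
    rw [← Real.log_nonneg_iff hμ0]
    linarith
  have hμm : maxTerm a r < Real.exp m := by rwa [← Real.log_lt_iff_lt_exp hμ0]
  have hlogr : Real.log r ≤ (m : ℝ) ^ 2 := by
    have h := Real.log_le_log (mul_pos hap' hr0) hμ
    rw [Real.log_mul hap'.ne' hr0.ne'] at h
    nlinarith [neg_abs_le (Real.log ‖a p‖)]
  -- Level k is exp(k + 1), so index `⌊ℓ⌋₊` is the level e^m.
  have hR := hE r hr0 hrE ⌊ℓ⌋₊ hμm
  have hS : maxTerm a r ≤ quadMean a r := maxTerm_le_quadMean ha hr0.le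
  have hS0 : 0 ≤ quadMean a r := (hpos r hr0).le
  have hdecay : ∀ n, ‖a n‖ * r ^ n * (1 + 1 / (2 * (m : ℝ) ^ 2)) ^ n ≤ Real.exp m := by
    intro n
    rw [mul_assoc, ← mul_pow]
    exact (norm_mul_pow_le_maxTerm ha (by positivity) n).trans hR.le
  set q : ℝ := Real.sqrt (Real.log ℓ) with hq
  have hq0 : 0 ≤ q := Real.sqrt_nonneg _
  refine Real.sSup_le ?_ (by positivity)
  rintro _ ⟨z, hz, rfl⟩
  have hzr : ‖z‖ = r := by simpa using hz
  have hmain := norm_powerSum_le_of_lattice ha hD.le hx hm1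
    (Λ := A * Real.sqrt (Real.log m)) (by positivity) h1 (z := z) (by rwa [hzr])
    (by rwa [hzr]) (by rwa [hzr])
  rw [hzr] at hmain
  have hAm : A * Real.sqrt (Real.log m) ≤ A * (2 * q) :=
    mul_le_mul_of_nonneg_left (sqrt_log_floor_add_one_le hℓ2) hA0
  calc ‖powerSum (fun n => a n * X n ω) z‖
      ≤ A * Real.sqrt (Real.log m) * quadMean a r + 4 * D * maxTerm a r + D * T := hmain
    _ ≤ A * (2 * q) * quadMean a r + 4 * D * quadMean a r + D * T * quadMean a r := by
      have hDT : D * T ≤ D * T * quadMean a r :=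
        le_mul_of_one_le_right (by positivity) (hμ1.trans hS)
      gcongr
    _ = A * (2 * q) * quadMean a r + D * (4 + T) * quadMean a r := by ring
    _ ≤ A * (2 * q) * quadMean a r + q * quadMean a r := by gcongr
    _ = (2 * A + 1) * q * quadMean a r := by ring
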